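/- Let $\mathcal{X}$ (candidates) and $\mathcal{V}$ (voters) be infinite sets. A \emph{profile} $\mathbf{P}$ is a function from a finite set $V(\mathbf{P})\subseteq\mathcal{V}$ to the set of strict linear orders on a finite set $X(\mathbf{P})\subseteq\mathcal{X}$. For a set $A$, $\mathbf{P}|_A$ is the profile obtained by restricting every ballot to the candidates in $A$, and $\mathbf{P}_{-y}=\mathbf{P}|_{X(\mathbf{P})\setminus\{y\}}$. The \emph{margin} of $x$ over $y$ in $\mathbf{P}$ is the number of voters ranking $x$ above $y$ minus the number ranking $y$ above $x$. The \emph{margin graph} $\mathcal{M}(\mathbf{P})$ is the weighted directed graph with node set $X(\mathbf{P})$ that has an edge from $x$ to $y$, weighted by the margin of $x$ over $y$, whenever this margin is positive. $\mathbf{P}$ (or $\mathcal{M}(\mathbf{P})$) is \emph{uniquely weighted} if for any two distinct ordered pairs $(a,b)\neq(c,d)$ of candidates in $X(\mathbf{P})$ with $a\neq b$ and $c\neq d$, the margin of $a$ over $b$ differs from the margin of $c$ over $d$. A \emph{voting method} $F$ assigns to each profile $\mathbf{P}$ in a nonempty set $\mathrm{dom}(F)$ of profiles a nonempty set $F(\mathbf{P})\subseteq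 X(\mathbf{P})$. In the following axioms all profiles are assumed to belong to $\mathrm{dom}(F)$. $F$ is \emph{pairwise} if $\mathcal{M}(\mathbf{P})=\mathcal{M}(\mathbf{P}')$ implies $F(\mathbf{P})=F(\mathbf{P}')$; it satisfies \emph{anonymity} if $F(\mathbf{P}')=F(\mathbf{P})$ whenever $\mathbf{P}'$ arises from $\mathbf{P}$ by swapping two elements $i,j$ of $\mathcal{V}$; \emph{neutrality} if $F(\mathbf{P}')=\pi[F(\mathbf{P})]$ whenever $\mathbf{P}'$ arises from $\mathbf{P}$ by applying the transposition $\pi$ of two elements $a,b$ of $\mathcal{X}$ to the candidates; \emph{binary $\gamma$} if $x\in F(\mathbf{P}_{-y})$ and $F(\mathbf{P}|_{\{x,y\}})=\{x\}$ imply $x\in F(\mathbf{P})$; and \emph{quasi-resoluteness} if $|F(\mathbf{P})|=1$ for every uniquely weighted $\mathbf{P}$. Proposition. For any $Y\subseteq\mathcal{X}$ with $|Y|\geq 4$, there is no pairwise voting method whose domain is the set of all profiles $\mathbf{P}$ such that $\varnothing\neq X(\mathbf{P})\subseteq Y$, $\mathcal{M}(\mathbf{P})$ is uniquely weighted, and all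 positive weights in $\mathcal{M}(\mathbf{P})$ belong to $\{2,4,6,8,10,12\}$, and which satisfies anonymity, neutrality, binary $\gamma$ and quasi-resoluteness. -/

import Mathlib

/-- `r` is a strict linear order on the finite set `X`, as a set of ordered pairs of elements
of `X`. -/
structure IsStrictLinearOrderOn {α : Type*} (X : Finset α) (r : α → α → Prop) : Prop where
  mem : ∀ x y, r x y → x ∈ X ∧ y ∈ X
  irrefl : ∀ x, ¬ r x x
  trans : ∀ x y z, r x y → r y z → r x z
  total : ∀ x ∈ X, ∀ y ∈ X, x ≠ y → r x y ∨ r y x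

/-- A profile: a function from a finite set of voters to the strict linear orders on a finite set
of candidates. `ballot i x y` says that voter `i` ranks `x` above `y`. The function is extended to
all of `𝒱` by the empty relation, so that two profiles are equal exactly when they have the same
voters, the same candidates and the same ballots. -/
@[ext]
structure Profile (𝒱 𝒳 : Type*) where
  voters : Finset 𝒱
  cands : Finset 𝒳
  ballot : 𝒱 → 𝒳 → 𝒳 → Prop
  ballot_linear : ∀ i ∈ voters, IsStrictLinearOrderOn cands (ballot i)
  ballot_off : ∀ i, i ∉ voters → ∀ x y, ¬ ballot i x y

/-- The data of a margin graph: a finite set of nodes and signed weights. There is an edge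
from `x` to `y` exactly when `weight x y` is positive, and then this is the weight of the edge. -/
@[ext]
structure MarginGraph (α : Type*) where
  nodes : Finset α
  weight : α → α → ℤ

/-- Distinct ordered pairs of distinct nodes have distinct weights. -/
def MarginGraph.UniquelyWeighted {α : Type*} (G : MarginGraph α) : Prop :=
  ∀ a ∈ G.nodes, ∀ b ∈ G.nodes, ∀ c ∈ G.nodes, ∀ d ∈ G.nodes,
    a ≠ b → c ≠ d → (a, b) ≠ (c, d) → G.weight a b ≠ G.weight c d

/-- All positive weights belong to `S`. -/
def MarginGraph.PositiveWeightsIn {α : Type*} (G : MarginGraph α) (S : Set ℤ) : Prop :=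
  ∀ a ∈ G.nodes, ∀ b ∈ G.nodes, 0 < G.weight a b → G.weight a b ∈ S

namespace Profile

open Classical in
/-- The number of voters who rank `x` above `y` minus the number who rank `y` above `x`. It is `0`
if `x` or `y` is not a candidate of the profile. -/
noncomputable def margin {𝒱 𝒳 : Type*} (P : Profile 𝒱 𝒳) (x y : 𝒳) : ℤ :=
  ((P.voters.filter fun i => P.ballot i x y).card : ℤ) -
    ((P.voters.filter fun i => P.ballot i y x).card : ℤ)

/-- The margin graph of a profile. -/
noncomputable def marginGraph {𝒱 𝒳 : Type*} (P : Profile 𝒱 𝒳) : MarginGraph 𝒳 where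
  nodes := P.cands
  weight := P.margin

/-- The profile in which every ballot is restricted to the candidates in `A`. -/
def restrict {𝒱 𝒳 : Type*} [DecidableEq 𝒳] (P : Profile 𝒱 𝒳) (A : Finset 𝒳) : Profile 𝒱 𝒳 where
  voters := P.voters
  cands := P.cands ∩ A
  ballot i x y := P.ballot i x y ∧ x ∈ A ∧ y ∈ A
  ballot_linear i hi :=
    { mem := fun x y h =>
        ⟨Finset.mem_inter.2 ⟨((P.ballot_linear i hi).mem x y h.1).1, h.2.1⟩,
          Finset.mem_inter.2 ⟨((P.ballot_linear i hi).mem x y h.1).2, h.2.2⟩⟩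
      irrefl := fun x h => (P.ballot_linear i hi).irrefl x h.1
      trans := fun x y z h h' =>
        ⟨(P.ballot_linear i hi).trans x y z h.1 h'.1, h.2.1, h'.2.2⟩
      total := fun x hx y hy hxy => by
        rw [Finset.mem_inter] at hx hy
        rcases (P.ballot_linear i hi).total x hx.1 y hy.1 hxy with h | h
        · exact Or.inl ⟨h, hx.2, hy.2⟩
        · exact Or.inr ⟨h, hy.2, hx.2⟩ }
  ballot_off i hi x y h := P.ballot_off i hi x y h.1

/-- The profile with candidate `y` removed. -/
def remove {𝒱 𝒳 : Type*} [DecidableEq 𝒳] (P : Profile 𝒱 𝒳) (y : 𝒳) : Profile 𝒱 𝒳 :=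
  P.restrict (P.cands \ {y})

/-- The profile with the voters `i` and `j` swapped. -/
def swapVoters {𝒱 𝒳 : Type*} [DecidableEq 𝒱] (P : Profile 𝒱 𝒳) (i j : 𝒱) : Profile 𝒱 𝒳 where
  voters := P.voters.map (Equiv.swap i j).toEmbedding
  cands := P.cands
  ballot k := P.ballot (Equiv.swap i j k)
  ballot_linear k hk := P.ballot_linear _ (by simpa [Finset.mem_map_equiv] using hk)
  ballot_off k hk := P.ballot_off _ (by simpa [Finset.mem_map_equiv] using hk)

/-- The profile with the candidates `a` and `b` swapped. -/
def swapCands {𝒱 𝒳 : Type*} [DecidableEq 𝒳] (P : Profile 𝒱 𝒳) (a b : 𝒳) : Profile 𝒱 𝒳 where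
  voters := P.voters
  cands := P.cands.map (Equiv.swap a b).toEmbedding
  ballot i x y := P.ballot i (Equiv.swap a b x) (Equiv.swap a b y)
  ballot_linear i hi :=
    { mem := fun x y h => by
        simpa [Finset.mem_map_equiv] using (P.ballot_linear i hi).mem _ _ h
      irrefl := fun x => (P.ballot_linear i hi).irrefl _
      trans := fun x y z => (P.ballot_linear i hi).trans _ _ _
      total := fun x hx y hy hxy =>
        (P.ballot_linear i hi).total _ (by simpa [Finset.mem_map_equiv] using hx)
          _ (by simpa [Finset.mem_map_equiv] using hy)
          (fun h => hxy ((Equiv.swap a b).injective h)) }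
  ballot_off i hi x y := P.ballot_off i hi _ _

end Profile

/-- A voting method: it assigns to each profile in a nonempty domain a nonempty set of candidates
of that profile. The values of `winners` outside of `dom` carry no meaning: neither the fields nor
the axioms below refer to them. -/
structure VotingMethod (𝒱 𝒳 : Type*) where
  dom : Set (Profile 𝒱 𝒳)
  dom_nonempty : dom.Nonempty
  winners : Profile 𝒱 𝒳 → Finset 𝒳
  winners_nonempty : ∀ P ∈ dom, (winners P).Nonempty
  winners_subset : ∀ P ∈ dom, winners P ⊆ P.cands

namespace VotingMethod

/-- The winners depend only on the margin graph. -/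
def Pairwise {𝒱 𝒳 : Type*} (F : VotingMethod 𝒱 𝒳) : Prop :=
  ∀ P ∈ F.dom, ∀ P' ∈ F.dom, P.marginGraph = P'.marginGraph → F.winners P = F.winners P'

def Anonymity {𝒱 𝒳 : Type*} [DecidableEq 𝒱] (F : VotingMethod 𝒱 𝒳) : Prop :=
  ∀ P ∈ F.dom, ∀ i j : 𝒱, P.swapVoters i j ∈ F.dom →
    F.winners (P.swapVoters i j) = F.winners P

def Neutrality {𝒱 𝒳 : Type*} [DecidableEq 𝒳] (F : VotingMethod 𝒱 𝒳) : Prop :=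
  ∀ P ∈ F.dom, ∀ a b : 𝒳, P.swapCands a b ∈ F.dom →
    F.winners (P.swapCands a b) = (F.winners P).map (Equiv.swap a b).toEmbedding

def BinaryGamma {𝒱 𝒳 : Type*} [DecidableEq 𝒳] (F : VotingMethod 𝒱 𝒳) : Prop :=
  ∀ P ∈ F.dom, ∀ x y : 𝒳, P.remove y ∈ F.dom → P.restrict {x, y} ∈ F.dom →
    x ∈ F.winners (P.remove y) → F.winners (P.restrict {x, y}) = {x} → x ∈ F.winners P

/-- There is a unique winner in every uniquely weighted profile of the domain. -/
def QuasiResoluteness {𝒱 𝒳 : Type*} (F : VotingMethod 𝒱 𝒳) : Prop :=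
  ∀ P ∈ F.dom, P.marginGraph.UniquelyWeighted → (F.winners P).card = 1

end VotingMethod

/-! ### A combinatorial impossibility for choices from cyclic triples -/

/-! Give each label `k` an arrow. A two-candidate profile with margin `k` has exactly one winner;
let `l k`, equal to `k` or `-k`, be the margin of the winner over the loser, and draw an arrow
labelled `k` from winner to loser, possibly against the majority. Neutrality and pairwiseness make
the outcome of two-candidate profiles and of three-candidate cycles depend only on the margins. So
let `W p q e` mean that, in a cycle of arrows labelled `p`, `q`, `e`, the candidate with outgoing
arrow `p` and incoming arrow `e` wins. By quasi-resoluteness every cycle has such a pick.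

For distinct labels, `W p q e` and `W s e r` exclude each other. Let `t` be the sixth label and take
the arrows a→c (`p`), c→d (`q`), d→a (`e`), a→b (`r`), b→d (`s`), b→c (`t`). Without b, candidate a
wins the cycle a, c, d, and a beats b; without c, candidate b wins the cycle b, d, a, and b beats c.
Binary γ makes both a and b winners of a uniquely weighted profile, against quasi-resoluteness
(`mem_winners_of_cycleWin`).

What remains is finite: no such picks exist on six labels (`not_exists_cyclic_choice`). The label
entering the winner of one cycle can never lie opposite the winner of a cycle sharing only that
label, and this forces picks until two of them clash. -/

/-- Suppose that one element of each cyclically ordered triple of six labels is picked, `W i j k`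
saying that `i` is picked from the cycle `i j k`, in such a way that two cycles `i j k` and `m k l`
with only `k` in common never have both `i` and `m` picked. Then `0` is not picked from
`0 1 2`. -/
theorem not_pick_of_cyclic_choice (W : Fin 6 → Fin 6 → Fin 6 → Prop)
    (tot : ∀ i j k, i ≠ j → i ≠ k → j ≠ k → W i j k ∨ W j k i ∨ W k i j)
    (conf : ∀ i j k l m, [i, j, k, l, m].Nodup → W i j k → ¬ W m k l) : ¬ W 0 1 2 := by
  intro h
  -- Split on the pick from a cycle sharing two labels with `0 1 2`. In each case two of the three
  -- picks from a further cycle are excluded by earlier ones, and the third forced pick produces the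
  -- clash.
  rcases tot 0 1 3 (by decide) (by decide) (by decide) with h' | h' | h'
  · have h1 : W 3 5 2 := (tot 3 5 2 (by decide) (by decide) (by decide)).resolve_right
      (not_or.2 ⟨fun w => conf 0 1 2 3 5 (by decide) h w,
        fun w => conf 0 1 3 5 2 (by decide) h' w⟩)
    have h2 : W 3 4 2 := (tot 3 4 2 (by decide) (by decide) (by decide)).resolve_right
      (not_or.2 ⟨fun w => conf 0 1 2 3 4 (by decide) h w,
        fun w => conf 0 1 3 4 2 (by decide) h' w⟩)
    have h3 : W 4 5 1 := (tot 4 5 1 (by decide) (by decide) (by decide)).resolve_right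
      (not_or.2 ⟨fun w => conf 5 1 4 2 3 (by decide) w h2,
        fun w => conf 1 4 5 2 3 (by decide) w h1⟩)
    exact conf 4 5 1 2 0 (by decide) h3 h
  · have h1 : W 5 3 2 := (tot 5 3 2 (by decide) (by decide) (by decide)).resolve_right
      (not_or.2 ⟨fun w => conf 0 1 2 5 3 (by decide) h w,
        fun w => conf 2 5 3 0 1 (by decide) w h'⟩)
    have h2 : W 1 3 4 := (tot 1 3 4 (by decide) (by decide) (by decide)).resolve_right
      (not_or.2 ⟨fun w => conf 3 4 1 2 0 (by decide) w h,
        fun w => conf 4 1 3 2 5 (by decide) w h1⟩)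
    have h3 : W 2 4 0 := (tot 2 4 0 (by decide) (by decide) (by decide)).resolve_right
      (not_or.2 ⟨fun w => conf 1 3 0 2 4 (by decide) h' w,
        fun w => conf 5 3 2 4 0 (by decide) h1 w⟩)
    exact conf 1 3 4 0 2 (by decide) h2 h3
  · have h1 : W 1 4 5 := (tot 1 4 5 (by decide) (by decide) (by decide)).resolve_right
      (not_or.2 ⟨fun w => conf 4 5 1 2 0 (by decide) w h,
        fun w => conf 3 0 1 4 5 (by decide) h' w⟩)
    have h2 : W 1 5 4 := (tot 1 5 4 (by decide) (by decide) (by decide)).resolve_right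
      (not_or.2 ⟨fun w => conf 5 4 1 2 0 (by decide) w h,
        fun w => conf 3 0 1 5 4 (by decide) h' w⟩)
    have h3 : W 4 2 3 := (tot 4 2 3 (by decide) (by decide) (by decide)).resolve_right
      (not_or.2 ⟨fun w => conf 2 3 4 5 1 (by decide) w h1,
        fun w => conf 1 5 4 2 3 (by decide) h2 w⟩)
    exact conf 0 1 2 3 4 (by decide) h h3

/-- No such picking exists for six or more labels. -/
theorem not_exists_cyclic_choice {α : Type*} (L : Finset α) (hL : 6 ≤ L.card)
    (W : α → α → α → Prop)
    (tot : ∀ p ∈ L, ∀ q ∈ L, ∀ e ∈ L, p ≠ q → p ≠ e → q ≠ e → W p q e ∨ W q e p ∨ W e p q)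
    (conf : ∀ p ∈ L, ∀ q ∈ L, ∀ e ∈ L, ∀ r ∈ L, ∀ s ∈ L, [p, q, e, r, s].Nodup →
      W p q e → ¬ W s e r) : False := by
  obtain ⟨T, hT, hc⟩ := Finset.exists_subset_card_eq hL
  have e : Fin 6 ≃ T := (Finset.equivFinOfCardEq hc).symm
  have key : ∀ g : Fin 6 ≃ T, ¬ W (g 0) (g 1) (g 2) := fun g => by
    have gi : Function.Injective fun i => (g i : α) := fun i j h => g.injective (Subtype.ext h)
    have gm : ∀ i, (g i : α) ∈ L := fun i => hT (g i).2
    exact not_pick_of_cyclic_choice (fun i j k => W (g i) (g j) (g k))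
      (fun i j k h₁ h₂ h₃ => tot _ (gm i) _ (gm j) _ (gm k) (gi.ne h₁) (gi.ne h₂) (gi.ne h₃))
      (fun i j k l m h => conf _ (gm i) _ (gm j) _ (gm k) _ (gm l) _ (gm m) (h.map gi))
  have ei : ∀ i j : Fin 6, i ≠ j → (e i : α) ≠ e j := fun i j h h' =>
    h (e.injective (Subtype.ext h'))
  rcases tot _ (hT (e 0).2) _ (hT (e 1).2) _ (hT (e 2).2) (ei _ _ (by decide))
    (ei _ _ (by decide)) (ei _ _ (by decide)) with h | h | h
  · exact key e h
  -- `key` holds for every labelling, so precomposing with a rotation of `0, 1, 2` turns the other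
  -- two picks into the first.
  · exact key ((⟨![1, 2, 0, 3, 4, 5], ![2, 0, 1, 3, 4, 5], by decide, by decide⟩ :
      Fin 6 ≃ Fin 6).trans e) h
  · exact key ((⟨![2, 0, 1, 3, 4, 5], ![1, 2, 0, 3, 4, 5], by decide, by decide⟩ :
      Fin 6 ≃ Fin 6).trans e) h

/-! ### Margins -/

namespace Profile

open Classical in
theorem margin_eq_sum {𝒱 𝒳 : Type*} (P : Profile 𝒱 𝒳) (x y : 𝒳) :
    P.margin x y = ∑ i ∈ P.voters,
      ((if P.ballot i x y then 1 else 0) - if P.ballot i y x then 1 else 0 : ℤ) := by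
  simp [margin, Finset.sum_sub_distrib]

theorem margin_swap {𝒱 𝒳 : Type*} (P : Profile 𝒱 𝒳) (x y : 𝒳) :
    P.margin y x = - P.margin x y := by
  simp [margin]

theorem ballot_mem {𝒱 𝒳 : Type*} (P : Profile 𝒱 𝒳) {i : 𝒱} {x y : 𝒳} (h : P.ballot i x y) :
    x ∈ P.cands ∧ y ∈ P.cands := by
  by_cases hi : i ∈ P.voters
  · exact (P.ballot_linear i hi).mem x y h
  · exact absurd h (P.ballot_off i hi x y)

/-- Ballots are empty off the candidates. Hence the weights, which are defined on all of `𝒳`, carry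
no information outside the nodes. -/
theorem margin_eq_zero_of_notMem {𝒱 𝒳 : Type*} (P : Profile 𝒱 𝒳) {x y : 𝒳}
    (h : ¬ (x ∈ P.cands ∧ y ∈ P.cands)) : P.margin x y = 0 := by
  classical
  rw [margin_eq_sum]
  refine Finset.sum_eq_zero fun i _ => ?_
  rw [if_neg fun hb => h (P.ballot_mem hb), if_neg fun hb => h (P.ballot_mem hb).symm, sub_self]

/-- Profiles with the same candidates have the same margin graph as soon as the margins between
candidates agree. -/
theorem marginGraph_eq {𝒱 𝒳 : Type*} {P Q : Profile 𝒱 𝒳} (hc : P.cands = Q.cands)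
    (h : ∀ x ∈ P.cands, ∀ y ∈ P.cands, P.margin x y = Q.margin x y) :
    P.marginGraph = Q.marginGraph := by
  refine MarginGraph.ext hc (funext₂ fun x y => ?_)
  by_cases hxy : x ∈ P.cands ∧ y ∈ P.cands
  · exact h x hxy.1 y hxy.2
  · exact (P.margin_eq_zero_of_notMem hxy).trans
      (Q.margin_eq_zero_of_notMem (hc ▸ hxy)).symm

theorem margin_restrict {𝒱 𝒳 : Type*} [DecidableEq 𝒳] (P : Profile 𝒱 𝒳) (A : Finset 𝒳) {x y : 𝒳}
    (hx : x ∈ A) (hy : y ∈ A) : (P.restrict A).margin x y = P.margin x y := by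
  classical
  rw [margin_eq_sum, margin_eq_sum]
  exact Finset.sum_congr rfl fun i _ => by simp [restrict, hx, hy]

theorem margin_swapCands {𝒱 𝒳 : Type*} [DecidableEq 𝒳] (P : Profile 𝒱 𝒳) (a b x y : 𝒳) :
    (P.swapCands a b).margin (Equiv.swap a b x) (Equiv.swap a b y) = P.margin x y := by
  classical
  rw [margin_eq_sum, margin_eq_sum]
  exact Finset.sum_congr rfl fun i _ => by simp [swapCands]

/-! ### Realizing margins -/

open Classical in
theorem exists_addVoter {𝒱 𝒳 : Type*} [Infinite 𝒱] (P : Profile 𝒱 𝒳) (r : 𝒳 → 𝒳 → Prop)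
    (hr : IsStrictLinearOrderOn P.cands r) :
    ∃ Q : Profile 𝒱 𝒳, Q.cands = P.cands ∧ ∀ x y, Q.margin x y =
      P.margin x y + ((if r x y then 1 else 0) - if r y x then 1 else 0) := by
  obtain ⟨i, hi⟩ := Infinite.exists_notMem_finset P.voters
  let Q : Profile 𝒱 𝒳 :=
    { voters := insert i P.voters
      cands := P.cands
      ballot := fun j => if j = i then r else P.ballot j
      ballot_linear := fun j hj => by
        split_ifs with h
        · exact hr
        · exact P.ballot_linear j ((Finset.mem_insert.1 hj).resolve_left h)
      ballot_off := fun j hj x y => by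
        rw [Finset.mem_insert, not_or] at hj
        rw [if_neg hj.1]
        exact P.ballot_off j hj.2 x y }
  refine ⟨Q, rfl, fun x y => ?_⟩
  have hQ : Q.voters = insert i P.voters := rfl
  have hi' : Q.ballot i = r := if_pos rfl
  rw [margin_eq_sum, margin_eq_sum, add_comm, hQ, Finset.sum_insert hi, hi']
  congr 1
  refine Finset.sum_congr rfl fun j hj => ?_
  have hj' : Q.ballot j = P.ballot j := if_neg (ne_of_mem_of_not_mem hj hi)
  rw [hj']

open Classical in
/-- The contribution of one edge from `x` to `y` of weight `1` to the margin of `u` over `v`. -/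
noncomputable def edge {𝒳 : Type*} (x y u v : 𝒳) : ℤ :=
  (if u = x ∧ v = y then 1 else 0) - if u = y ∧ v = x then 1 else 0

/-- Two more voters, both of whom rank `x` above `y` but who otherwise have opposite rankings,
raise the margin of `x` over `y` by `2`. -/
theorem exists_margin_add_two {𝒱 𝒳 : Type*} [Infinite 𝒱] (P : Profile 𝒱 𝒳) {x y : 𝒳}
    (hx : x ∈ P.cands) (hy : y ∈ P.cands) (hxy : x ≠ y) :
    ∃ Q : Profile 𝒱 𝒳, Q.cands = P.cands ∧
      ∀ u v, Q.margin u v = P.margin u v + 2 * edge x y u v := by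
  classical
  let r : 𝒳 → 𝒳 → Prop := WellOrderingRel
  have rirr : ∀ u, ¬ r u u := fun u => irrefl u
  have rtr : ∀ u v w, r u v → r v w → r u w := fun u v w => _root_.trans
  have rtot : ∀ u v, u ≠ v → r u v ∨ r v u := fun u v h =>
    (trichotomous_of r u v).imp_right fun h' => h'.resolve_left h
  -- `r₁` ranks `x`, then `y`, then the others by `r`; `r₂` ranks the others by the reverse of `r`,
  -- then `x`, then `y`. Only the pair `x`, `y` fails to cancel.
  let r₁ : 𝒳 → 𝒳 → Prop := fun u v => (u ∈ P.cands ∧ v ∈ P.cands) ∧ u ≠ v ∧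
    (u = x ∨ u = y ∧ v ≠ x ∨ (u ≠ x ∧ u ≠ y ∧ v ≠ x ∧ v ≠ y) ∧ r u v)
  let r₂ : 𝒳 → 𝒳 → Prop := fun u v => (u ∈ P.cands ∧ v ∈ P.cands) ∧ u ≠ v ∧
    (v = y ∨ v = x ∧ u ≠ y ∨ (u ≠ x ∧ u ≠ y ∧ v ≠ x ∧ v ≠ y) ∧ r v u)
  have h₁ : IsStrictLinearOrderOn P.cands r₁ :=
    { mem := fun u v h => h.1
      irrefl := fun u h => h.2.1 rfl
      trans := fun u v w => by grind
      total := fun u hu v hv huv => by grind }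
  have h₂ : IsStrictLinearOrderOn P.cands r₂ :=
    { mem := fun u v h => h.1
      irrefl := fun u h => h.2.1 rfl
      trans := fun u v w => by grind
      total := fun u hu v hv huv => by grind }
  obtain ⟨Q, hQ, hQm⟩ := P.exists_addVoter r₁ h₁
  obtain ⟨R, hR, hRm⟩ := Q.exists_addVoter r₂ (hQ ▸ h₂)
  refine ⟨R, hR.trans hQ, fun u v => ?_⟩
  have huv : (u = x ∧ v = y → u ∈ P.cands ∧ v ∈ P.cands) ∧
      (u = y ∧ v = x → u ∈ P.cands ∧ v ∈ P.cands) := by grind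
  rw [hRm, hQm, edge]
  clear hRm hQm h₁ h₂ rtr rtot
  by_cases hc : u ∈ P.cands ∧ v ∈ P.cands
  · by_cases huv : u = v
    · grind
    · simp only [r₁, r₂, hc, huv, Ne.symm huv, ne_eq, not_false_eq_true, and_self, true_and]
      by_cases ux : u = x <;> by_cases uy : u = y <;> by_cases vx : v = x <;>
        by_cases vy : v = y <;> simp_all <;> ring
  · rw [if_neg (mt huv.1 hc), if_neg (mt huv.2 hc)]
    simp only [r₁, r₂, hc, and_comm (a := v ∈ P.cands), false_and, if_false]
    simp

theorem exists_margin_add_nat {𝒱 𝒳 : Type*} [Infinite 𝒱] (P : Profile 𝒱 𝒳) {x y : 𝒳}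
    (hx : x ∈ P.cands) (hy : y ∈ P.cands) (hxy : x ≠ y) (n : ℕ) :
    ∃ Q : Profile 𝒱 𝒳, Q.cands = P.cands ∧
      ∀ u v, Q.margin u v = P.margin u v + 2 * n * edge x y u v := by
  induction n with
  | zero => exact ⟨P, rfl, by simp⟩
  | succ n ih =>
    obtain ⟨Q, hQ, h⟩ := ih
    obtain ⟨R, hR, h'⟩ := Q.exists_margin_add_two (hQ ▸ hx) (hQ ▸ hy) hxy
    refine ⟨R, hR.trans hQ, fun u v => ?_⟩
    rw [h', h]
    push_cast
    ring

/-- The margin of `x` over `y` can be changed by any even number. -/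
theorem exists_margin_add {𝒱 𝒳 : Type*} [Infinite 𝒱] (P : Profile 𝒱 𝒳) {x y : 𝒳}
    (hx : x ∈ P.cands) (hy : y ∈ P.cands) (hxy : x ≠ y) {m : ℤ} (hm : Even m) :
    ∃ Q : Profile 𝒱 𝒳, Q.cands = P.cands ∧
      ∀ u v, Q.margin u v = P.margin u v + m * edge x y u v := by
  obtain ⟨k, rfl⟩ := hm
  obtain ⟨n, rfl | rfl⟩ := k.eq_nat_or_neg
  · obtain ⟨Q, hQ, h⟩ := P.exists_margin_add_nat hx hy hxy n
    exact ⟨Q, hQ, fun u v => by rw [h]; ring⟩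
  -- A negative change is a positive one for the reversed pair, since `edge` is antisymmetric.
  · obtain ⟨Q, hQ, h⟩ := P.exists_margin_add_nat hy hx hxy.symm n
    exact ⟨Q, hQ, fun u v => by rw [h, edge, edge]; ring⟩

/-- Any even margins between four candidates are realized by a profile. -/
theorem exists_margins_four {𝒱 𝒳 : Type*} [Infinite 𝒱] [DecidableEq 𝒳] {a b c d : 𝒳}
    (hab : a ≠ b) (hac : a ≠ c) (had : a ≠ d) (hbc : b ≠ c) (hbd : b ≠ d) (hcd : c ≠ d)
    {m₁ m₂ m₃ m₄ m₅ m₆ : ℤ} (h₁ : Even m₁) (h₂ : Even m₂) (h₃ : Even m₃) (h₄ : Even m₄)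
    (h₅ : Even m₅) (h₆ : Even m₆) :
    ∃ P : Profile 𝒱 𝒳, P.cands = {a, b, c, d} ∧ P.margin a b = m₁ ∧ P.margin a c = m₂ ∧
      P.margin a d = m₃ ∧ P.margin b c = m₄ ∧ P.margin b d = m₅ ∧ P.margin c d = m₆ := by
  -- Start without voters, so that all margins vanish, and set the six pairs one at a time; no
  -- adjustment disturbs the other pairs.
  let P₀ : Profile 𝒱 𝒳 := ⟨∅, {a, b, c, d}, fun _ _ _ => False, by simp, by simp⟩
  have hP₀ : ∀ u v, P₀.margin u v = 0 := fun u v => by simp [margin, P₀]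
  obtain ⟨P₁, c₁, e₁⟩ := P₀.exists_margin_add (x := a) (y := b) (by simp [P₀]) (by simp [P₀]) hab h₁
  obtain ⟨P₂, c₂, e₂⟩ := P₁.exists_margin_add (x := a) (y := c) (by simp [c₁, P₀])
    (by simp [c₁, P₀]) hac h₂
  obtain ⟨P₃, c₃, e₃⟩ := P₂.exists_margin_add (x := a) (y := d) (by simp [c₂, c₁, P₀])
    (by simp [c₂, c₁, P₀]) had h₃
  obtain ⟨P₄, c₄, e₄⟩ := P₃.exists_margin_add (x := b) (y := c) (by simp [c₃, c₂, c₁, P₀])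
    (by simp [c₃, c₂, c₁, P₀]) hbc h₄
  obtain ⟨P₅, c₅, e₅⟩ := P₄.exists_margin_add (x := b) (y := d) (by simp [c₄, c₃, c₂, c₁, P₀])
    (by simp [c₄, c₃, c₂, c₁, P₀]) hbd h₅
  obtain ⟨P₆, c₆, e₆⟩ := P₅.exists_margin_add (x := c) (y := d)
    (by simp [c₅, c₄, c₃, c₂, c₁, P₀]) (by simp [c₅, c₄, c₃, c₂, c₁, P₀]) hcd h₆
  refine ⟨P₆, by rw [c₆, c₅, c₄, c₃, c₂, c₁], ?_⟩
  simp [e₆, e₅, e₄, e₃, e₂, e₁, hP₀, edge, hab, hac, had, hbc, hbd, hcd, hab.symm, hac.symm,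
    had.symm, hbc.symm, hbd.symm, hcd.symm]

end Profile

/-! ### The domain -/

namespace Profile

/-- The profiles with candidates in `Y`, all of whose margins are distinct, the positive ones being
among `2, 4, 6, 8, 10, 12`. -/
def Admissible {𝒱 𝒳 : Type*} (Y : Set 𝒳) (P : Profile 𝒱 𝒳) : Prop :=
  P.cands.Nonempty ∧ (P.cands : Set 𝒳) ⊆ Y ∧ P.marginGraph.UniquelyWeighted ∧
    P.marginGraph.PositiveWeightsIn {2, 4, 6, 8, 10, 12}

/-- Both restrictions in binary γ therefore stay in the domain. -/
theorem Admissible.restrict {𝒱 𝒳 : Type*} [DecidableEq 𝒳] {Y : Set 𝒳} {P : Profile 𝒱 𝒳}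
    (h : P.Admissible Y) {A : Finset 𝒳} (hA : (P.cands ∩ A).Nonempty) :
    (P.restrict A).Admissible Y := by
  obtain ⟨-, hY, hu, hp⟩ := h
  have key : ∀ x ∈ P.cands ∩ A, ∀ y ∈ P.cands ∩ A,
      (P.restrict A).margin x y = P.margin x y := fun x hx y hy =>
    P.margin_restrict A (Finset.mem_inter.1 hx).2 (Finset.mem_inter.1 hy).2
  have sub : P.cands ∩ A ⊆ P.cands := Finset.inter_subset_left
  refine ⟨hA, fun x hx => hY (sub hx), fun a ha b hb c hc d hd hab hcd h => ?_,
    fun a ha b hb => ?_⟩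
  · change (P.restrict A).margin a b ≠ (P.restrict A).margin c d
    rw [key a ha b hb, key c hc d hd]
    exact hu a (sub ha) b (sub hb) c (sub hc) d (sub hd) hab hcd h
  · change 0 < (P.restrict A).margin a b → (P.restrict A).margin a b ∈ _
    rw [key a ha b hb]
    exact hp a (sub ha) b (sub hb)

theorem Admissible.swapCands {𝒱 𝒳 : Type*} [DecidableEq 𝒳] {Y : Set 𝒳} {P : Profile 𝒱 𝒳}
    (h : P.Admissible Y) {a b : 𝒳} (ha : a ∈ Y) (hb : b ∈ Y) :
    (P.swapCands a b).Admissible Y := by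
  obtain ⟨hne, hY, hu, hp⟩ := h
  have hc : ∀ z, z ∈ (P.swapCands a b).cands → ∃ x ∈ P.cands, z = Equiv.swap a b x := fun z hz => by
    obtain ⟨x, hx, rfl⟩ := Finset.mem_map.1 hz
    exact ⟨x, hx, rfl⟩
  refine ⟨hne.map, fun z hz => ?_, fun z₁ h₁ z₂ h₂ z₃ h₃ z₄ h₄ => ?_, fun z₁ h₁ z₂ h₂ => ?_⟩
  · obtain ⟨x, hx, rfl⟩ := hc z hz
    rw [Equiv.swap_apply_def]
    split_ifs
    exacts [hb, ha, hY hx]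
  · obtain ⟨x₁, k₁, rfl⟩ := hc z₁ h₁
    obtain ⟨x₂, k₂, rfl⟩ := hc z₂ h₂
    obtain ⟨x₃, k₃, rfl⟩ := hc z₃ h₃
    obtain ⟨x₄, k₄, rfl⟩ := hc z₄ h₄
    simp only [marginGraph, margin_swapCands]
    intro hab hcd h
    exact hu x₁ k₁ x₂ k₂ x₃ k₃ x₄ k₄ (fun e => hab (e ▸ rfl)) (fun e => hcd (e ▸ rfl))
      (fun e => h (by rw [(Prod.mk.inj e).1, (Prod.mk.inj e).2]))
  · obtain ⟨x₁, k₁, rfl⟩ := hc z₁ h₁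
    obtain ⟨x₂, k₂, rfl⟩ := hc z₂ h₂
    simp only [marginGraph, margin_swapCands]
    exact hp x₁ k₁ x₂ k₂

/-- The labels of edges. -/
def labels : Finset ℤ := {2, 4, 6, 8, 10, 12}

set_option linter.unusedSimpArgs false in
set_option maxHeartbeats 1000000 in
/-- Four candidates can be given any margins with distinct absolute values in `labels`. -/
theorem exists_admissible_four {𝒱 𝒳 : Type*} [Infinite 𝒱] [DecidableEq 𝒳] {Y : Set 𝒳}
    {a b c d : 𝒳} (ha : a ∈ Y) (hb : b ∈ Y) (hc : c ∈ Y) (hd : d ∈ Y) (hab : a ≠ b) (hac : a ≠ c)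
    (had : a ≠ d) (hbc : b ≠ c) (hbd : b ≠ d) (hcd : c ≠ d) {m₁ m₂ m₃ m₄ m₅ m₆ : ℤ}
    (hm : [|m₁|, |m₂|, |m₃|, |m₄|, |m₅|, |m₆|].Nodup)
    (hl : ∀ m ∈ [m₁, m₂, m₃, m₄, m₅, m₆], |m| ∈ labels) :
    ∃ P : Profile 𝒱 𝒳, P.Admissible Y ∧ P.cands = {a, b, c, d} ∧ P.margin a b = m₁ ∧
      P.margin a c = m₂ ∧ P.margin a d = m₃ ∧ P.margin b c = m₄ ∧ P.margin b d = m₅ ∧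
      P.margin c d = m₆ := by
  have he : ∀ m ∈ [m₁, m₂, m₃, m₄, m₅, m₆], Even m := fun m h => by
    have := hl m h
    rw [← even_abs]
    simp only [labels, Finset.mem_insert, Finset.mem_singleton] at this
    rcases this with h | h | h | h | h | h <;> rw [h] <;> decide
  have hpos : ∀ m ∈ [m₁, m₂, m₃, m₄, m₅, m₆], m ≠ 0 := fun m h e => by
    have := hl m h
    simp [e, labels] at this
  obtain ⟨P, hP, e₁, e₂, e₃, e₄, e₅, e₆⟩ := exists_margins_four (𝒱 := 𝒱) hab hac had hbc hbd hcd
    (he m₁ (by simp)) (he m₂ (by simp)) (he m₃ (by simp)) (he m₄ (by simp)) (he m₅ (by simp))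
    (he m₆ (by simp))
  have s₁ := P.margin_swap a b
  have s₂ := P.margin_swap a c
  have s₃ := P.margin_swap a d
  have s₄ := P.margin_swap b c
  have s₅ := P.margin_swap b d
  have s₆ := P.margin_swap c d
  rw [e₁] at s₁
  rw [e₂] at s₂
  rw [e₃] at s₃
  rw [e₄] at s₄
  rw [e₅] at s₅
  rw [e₆] at s₆
  have hself : ∀ x, P.margin x x = 0 := fun x => by simp [margin]
  refine ⟨P, ⟨by simp [hP], ?_, ?_, ?_⟩, hP, e₁, e₂, e₃, e₄, e₅, e₆⟩
  · simp [hP, Set.insert_subset_iff, ha, hb, hc, hd]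
  · simp only [MarginGraph.UniquelyWeighted, marginGraph, hP]
    have p₁ := hpos m₁ (by simp)
    have p₂ := hpos m₂ (by simp)
    have p₃ := hpos m₃ (by simp)
    have p₄ := hpos m₄ (by simp)
    have p₅ := hpos m₅ (by simp)
    have p₆ := hpos m₆ (by simp)
    simp only [List.nodup_cons, List.mem_cons, List.not_mem_nil, or_false, not_or, not_false_eq_true,
      List.nodup_nil, and_true] at hm
    obtain ⟨⟨q₁₂, q₁₃, q₁₄, q₁₅, q₁₆⟩, ⟨q₂₃, q₂₄, q₂₅, q₂₆⟩, ⟨q₃₄, q₃₅, q₃₆⟩, ⟨q₄₅, q₄₆⟩, q₅₆⟩ := hm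
    simp only [Finset.mem_insert, Finset.mem_singleton]
    rintro x₁ h₁ x₂ h₂ x₃ h₃ x₄ h₄ h₁₂ h₃₄ h
    clear hl hpos he hself hP
    rcases h₁ with rfl | rfl | rfl | rfl <;> rcases h₂ with rfl | rfl | rfl | rfl <;>
      first | exact absurd rfl h₁₂ | skip
    all_goals
      simp only [e₁, e₂, e₃, e₄, e₅, e₆, s₁, s₂, s₃, s₄, s₅, s₆]
      rcases h₃ with rfl | rfl | rfl | rfl <;> rcases h₄ with rfl | rfl | rfl | rfl <;>
        first | exact absurd rfl h₃₄ | exact absurd rfl h | skip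
    all_goals
      simp only [e₁, e₂, e₃, e₄, e₅, e₆, s₁, s₂, s₃, s₄, s₅, s₆]
      -- Either the two weights are `m` and `-m` with `m ≠ 0`, or they belong to different pairs and
      -- already differ in absolute value.
      first
      | exact self_ne_neg.2 ‹_›
      | exact neg_ne_self.2 ‹_›
      | refine ne_of_apply_ne abs ?_
        try simp only [abs_neg]
        first | assumption | exact Ne.symm ‹_›
  · simp only [MarginGraph.PositiveWeightsIn, marginGraph, hP]
    have hl' : ∀ m ∈ [m₁, m₂, m₃, m₄, m₅, m₆],
        (0 < m → m ∈ ({2, 4, 6, 8, 10, 12} : Set ℤ)) ∧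
          (0 < -m → -m ∈ ({2, 4, 6, 8, 10, 12} : Set ℤ)) := fun m h => by
      have := hl m h
      simp only [labels, Finset.mem_insert, Finset.mem_singleton] at this
      simp only [Set.mem_insert_iff, Set.mem_singleton_iff]
      rcases abs_choice m with e | e <;> rw [e] at this <;> omega
    obtain ⟨t₁, u₁⟩ := hl' m₁ (by simp)
    obtain ⟨t₂, u₂⟩ := hl' m₂ (by simp)
    obtain ⟨t₃, u₃⟩ := hl' m₃ (by simp)
    obtain ⟨t₄, u₄⟩ := hl' m₄ (by simp)
    obtain ⟨t₅, u₅⟩ := hl' m₅ (by simp)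
    obtain ⟨t₆, u₆⟩ := hl' m₆ (by simp)
    simp only [Finset.mem_insert, Finset.mem_singleton]
    rintro x₁ h₁ x₂ h₂
    rcases h₁ with rfl | rfl | rfl | rfl <;> rcases h₂ with rfl | rfl | rfl | rfl <;>
      simp only [e₁, e₂, e₃, e₄, e₅, e₆, s₁, s₂, s₃, s₄, s₅, s₆, hself, lt_irrefl, false_imp_iff] <;>
      assumption

end Profile

/-! ### Cyclic profiles on three candidates -/

namespace Profile

theorem abs_of_mem_labels : ∀ u ∈ labels, |u| = u := by decide

theorem exists_three_labels {S : Finset ℤ} (hS : S ⊆ labels) (h : S.card = 3) :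
    ∃ r ∈ labels, ∃ s ∈ labels, ∃ t ∈ labels, r ∉ S ∧ s ∉ S ∧ t ∉ S ∧ r ≠ s ∧ r ≠ t ∧ s ≠ t := by
  obtain ⟨r, s, t, hrs, hrt, hst, e⟩ := Finset.card_eq_three.1
    (show (labels \ S).card = 3 by rw [Finset.card_sdiff_of_subset hS, h]; decide)
  have key : ∀ u ∈ ({r, s, t} : Finset ℤ), u ∈ labels ∧ u ∉ S := fun u hu => by
    rwa [← e, Finset.mem_sdiff] at hu
  exact ⟨r, (key r (by simp)).1, s, (key s (by simp)).1, t, (key t (by simp)).1,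
    (key r (by simp)).2, (key s (by simp)).2, (key t (by simp)).2, hrs, hrt, hst⟩

/-- Three candidates can be given any cyclic margins with distinct absolute values in `labels`. -/
theorem exists_admissible_three {𝒱 𝒳 : Type*} [Infinite 𝒱] [DecidableEq 𝒳] {Y : Set 𝒳}
    {a b c d : 𝒳} (ha : a ∈ Y) (hb : b ∈ Y) (hc : c ∈ Y) (hd : d ∈ Y) (hab : a ≠ b) (hac : a ≠ c)
    (had : a ≠ d) (hbc : b ≠ c) (hbd : b ≠ d) (hcd : c ≠ d) {m₁ m₂ m₃ : ℤ}
    (h₁ : |m₁| ∈ labels) (h₂ : |m₂| ∈ labels) (h₃ : |m₃| ∈ labels)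
    (h₁₂ : |m₁| ≠ |m₂|) (h₁₃ : |m₁| ≠ |m₃|) (h₂₃ : |m₂| ≠ |m₃|) :
    ∃ P : Profile 𝒱 𝒳, P.Admissible Y ∧ P.cands = {a, b, c} ∧ P.margin a b = m₁ ∧
      P.margin b c = m₂ ∧ P.margin c a = m₃ := by
  obtain ⟨r, hr, s, hs, t, ht, hr', hs', ht', hrs, hrt, hst⟩ := exists_three_labels
    (S := {|m₁|, |m₂|, |m₃|}) (by simp [Finset.insert_subset_iff, h₁, h₂, h₃])
    (Finset.card_eq_three.2 ⟨_, _, _, h₁₂, h₁₃, h₂₃, rfl⟩)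
  have ar := abs_of_mem_labels r hr
  have as := abs_of_mem_labels s hs
  have at' := abs_of_mem_labels t ht
  -- The three spare labels fill the edges at `d`, which is then deleted. The sign of `-m₃` appears
  -- because the cycle runs from `c` to `a`.
  obtain ⟨P, hP, hPc, e₁, e₂, -, e₃, -, -⟩ := exists_admissible_four (𝒱 := 𝒱)
    ha hb hc hd hab hac had hbc hbd hcd (m₁ := m₁) (m₂ := -m₃) (m₃ := r) (m₄ := m₂) (m₅ := s)
    (m₆ := t) (by
      simp only [abs_neg, ar, as, at']
      simp only [Finset.mem_insert, Finset.mem_singleton] at hr' hs' ht'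
      grind) (by
      simp only [List.forall_mem_cons, abs_neg, ar, as, at']
      exact ⟨h₁, h₃, hr, h₂, hs, ht, by simp⟩)
  refine ⟨P.restrict {a, b, c}, hP.restrict ⟨a, by simp [hPc]⟩, ?_, ?_, ?_, ?_⟩
  · exact Finset.inter_eq_right.2 (by simp [hPc, Finset.insert_subset_iff])
  · rw [margin_restrict _ _ (by simp) (by simp), e₁]
  · rw [margin_restrict _ _ (by simp) (by simp), e₃]
  · rw [margin_restrict _ _ (by simp) (by simp), margin_swap, e₂, neg_neg]

end Profile

/-! ### Neutral pairwise voting methods -/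

namespace VotingMethod

/-- Permuting the candidates by `π`, which preserves `Y`, permutes the winners accordingly. -/
def RespectsPerm {𝒱 𝒳 : Type*} (F : VotingMethod 𝒱 𝒳) (Y : Set 𝒳) (π : Equiv.Perm 𝒳) : Prop :=
  (∀ y ∈ Y, π y ∈ Y) ∧ ∀ P ∈ F.dom, ∃ Q ∈ F.dom, Q.cands = P.cands.map π.toEmbedding ∧
    (∀ x y, Q.margin (π x) (π y) = P.margin x y) ∧ F.winners Q = (F.winners P).map π.toEmbedding

/-- `RespectsPerm` asks only for some profile with the right candidates, margins and winners, so
permutations compose without building permuted ballots. -/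
theorem RespectsPerm.mul {𝒱 𝒳 : Type*} {F : VotingMethod 𝒱 𝒳} {Y : Set 𝒳} {π σ : Equiv.Perm 𝒳}
    (hπ : F.RespectsPerm Y π) (hσ : F.RespectsPerm Y σ) : F.RespectsPerm Y (π * σ) := by
  refine ⟨fun y hy => hπ.1 _ (hσ.1 y hy), fun P hP => ?_⟩
  obtain ⟨Q, hQ, hc, hm, hw⟩ := hσ.2 P hP
  obtain ⟨R, hR, hc', hm', hw'⟩ := hπ.2 Q hQ
  refine ⟨R, hR, ?_, fun x y => (hm' _ _).trans (hm x y), ?_⟩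
  · rw [hc', hc, Finset.map_map]
    rfl
  · rw [hw', hw, Finset.map_map]
    rfl

theorem respectsPerm_swap {𝒱 𝒳 : Type*} [DecidableEq 𝒳] {F : VotingMethod 𝒱 𝒳} {Y : Set 𝒳}
    (hF : F.dom = {P | P.Admissible Y}) (hN : F.Neutrality) {a b : 𝒳} (ha : a ∈ Y) (hb : b ∈ Y) :
    F.RespectsPerm Y (Equiv.swap a b) := by
  refine ⟨fun y hy => ?_, fun P hP => ?_⟩
  · rw [Equiv.swap_apply_def]
    split_ifs
    exacts [hb, ha, hy]
  · have hQ : P.swapCands a b ∈ F.dom := by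
      rw [hF] at hP ⊢
      exact Profile.Admissible.swapCands hP ha hb
    exact ⟨_, hQ, rfl, P.margin_swapCands a b, hN P hP a b hQ⟩

/-- Neutrality speaks of transpositions only; three of them, composed, move any three points of `Y`
to any three others. Each new swap moves neither of the targets already reached. -/
theorem exists_respectsPerm {𝒱 𝒳 : Type*} [DecidableEq 𝒳] {F : VotingMethod 𝒱 𝒳} {Y : Set 𝒳}
    (hF : F.dom = {P | P.Admissible Y}) (hN : F.Neutrality) {x₁ x₂ x₃ y₁ y₂ y₃ : 𝒳}
    (hx₁ : x₁ ∈ Y) (hx₂ : x₂ ∈ Y) (hx₃ : x₃ ∈ Y) (hy₁ : y₁ ∈ Y) (hy₂ : y₂ ∈ Y) (hy₃ : y₃ ∈ Y)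
    (hx₁₂ : x₁ ≠ x₂) (hx₁₃ : x₁ ≠ x₃) (hx₂₃ : x₂ ≠ x₃)
    (hy₁₂ : y₁ ≠ y₂) (hy₁₃ : y₁ ≠ y₃) (hy₂₃ : y₂ ≠ y₃) :
    ∃ π, F.RespectsPerm Y π ∧ π x₁ = y₁ ∧ π x₂ = y₂ ∧ π x₃ = y₃ := by
  have step₁ : ∃ π, F.RespectsPerm Y π ∧ π x₁ = y₁ :=
    ⟨_, respectsPerm_swap hF hN hx₁ hy₁, Equiv.swap_apply_left _ _⟩
  have step₂ : ∃ π, F.RespectsPerm Y π ∧ π x₁ = y₁ ∧ π x₂ = y₂ := by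
    obtain ⟨π, hπ, h₁⟩ := step₁
    refine ⟨_, (respectsPerm_swap hF hN (hπ.1 _ hx₂) hy₂).mul hπ, ?_, Equiv.swap_apply_left _ _⟩
    rw [Equiv.Perm.mul_apply, h₁]
    exact Equiv.swap_apply_of_ne_of_ne (h₁ ▸ π.injective.ne hx₁₂) hy₁₂
  obtain ⟨π, hπ, h₁, h₂⟩ := step₂
  refine ⟨_, (respectsPerm_swap hF hN (hπ.1 _ hx₃) hy₃).mul hπ, ?_, ?_, Equiv.swap_apply_left _ _⟩
  · rw [Equiv.Perm.mul_apply, h₁]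
    exact Equiv.swap_apply_of_ne_of_ne (h₁ ▸ π.injective.ne hx₁₃) hy₁₃
  · rw [Equiv.Perm.mul_apply, h₂]
    exact Equiv.swap_apply_of_ne_of_ne (h₂ ▸ π.injective.ne hx₂₃) hy₂₃

/-- Any `Q` with the transported margins has the same margin graph as the profile that
`RespectsPerm` supplies, so pairwiseness transfers the winners. -/
theorem RespectsPerm.winners_eq {𝒱 𝒳 : Type*} {F : VotingMethod 𝒱 𝒳} {Y : Set 𝒳}
    {π : Equiv.Perm 𝒳} (hπ : F.RespectsPerm Y π) (hF : F.Pairwise) {P Q : Profile 𝒱 𝒳}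
    (hP : P ∈ F.dom) (hQ : Q ∈ F.dom) (hc : Q.cands = P.cands.map π.toEmbedding)
    (hm : ∀ x ∈ P.cands, ∀ y ∈ P.cands, Q.margin (π x) (π y) = P.margin x y) :
    F.winners Q = (F.winners P).map π.toEmbedding := by
  obtain ⟨R, hR, hRc, hRm, hRw⟩ := hπ.2 P hP
  rw [← hRw]
  refine hF Q hQ R hR (Profile.marginGraph_eq (hc.trans hRc.symm) fun u hu v hv => ?_)
  rw [hc] at hu hv
  obtain ⟨x, hx, rfl⟩ := Finset.mem_map.1 hu
  obtain ⟨y, hy, rfl⟩ := Finset.mem_map.1 hv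
  exact (hm x hx y hy).trans (hRm x y).symm

/-! ### Winning as a property of the margins alone -/

/-- In some profile whose margins form a cycle `x`, `y`, `z` with weights `m₁`, `m₂`, `m₃`, the
candidate `x` wins. -/
def CycleWin {𝒱 𝒳 : Type*} [DecidableEq 𝒳] (F : VotingMethod 𝒱 𝒳) (m₁ m₂ m₃ : ℤ) : Prop :=
  ∃ P ∈ F.dom, ∃ x y z : 𝒳, x ≠ y ∧ x ≠ z ∧ y ≠ z ∧ P.cands = {x, y, z} ∧ P.margin x y = m₁ ∧
    P.margin y z = m₂ ∧ P.margin z x = m₃ ∧ x ∈ F.winners P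

/-- In some profile with the two candidates `x` and `y`, the margin of `x` over `y` is `m` and
`x` is the only winner. -/
def EdgeWin {𝒱 𝒳 : Type*} [DecidableEq 𝒳] (F : VotingMethod 𝒱 𝒳) (m : ℤ) : Prop :=
  ∃ P ∈ F.dom, ∃ x y : 𝒳, x ≠ y ∧ P.cands = {x, y} ∧ P.margin x y = m ∧ F.winners P = {x}

theorem mem_of_mem_cands {𝒱 𝒳 : Type*} {F : VotingMethod 𝒱 𝒳} {Y : Set 𝒳}
    (hF : F.dom = {P | P.Admissible Y}) {P : Profile 𝒱 𝒳} (hP : P ∈ F.dom) {x : 𝒳}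
    (hx : x ∈ P.cands) : x ∈ Y := by
  rw [hF] at hP
  exact hP.2.1 hx

section

variable {𝒱 𝒳 : Type*} [DecidableEq 𝒳] {F : VotingMethod 𝒱 𝒳} {Y : Set 𝒳}

/-- Upgrades "some profile" in the definition to "every profile with these cyclic margins", by
carrying the one cycle onto the other. -/
theorem CycleWin.mem_winners (hF : F.dom = {P | P.Admissible Y}) (hN : F.Neutrality)
    (hPw : F.Pairwise) {m₁ m₂ m₃ : ℤ} (h : F.CycleWin m₁ m₂ m₃) {Q : Profile 𝒱 𝒳}
    (hQ : Q ∈ F.dom) {a b c : 𝒳} (hab : a ≠ b) (hac : a ≠ c) (hbc : b ≠ c)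
    (hc : Q.cands = {a, b, c}) (h₁ : Q.margin a b = m₁) (h₂ : Q.margin b c = m₂)
    (h₃ : Q.margin c a = m₃) : a ∈ F.winners Q := by
  obtain ⟨P, hP, x, y, z, hxy, hxz, hyz, hPc, e₁, e₂, e₃, hx⟩ := h
  have hY : ∀ u ∈ P.cands, u ∈ Y := fun u => mem_of_mem_cands hF hP
  have hY' : ∀ u ∈ Q.cands, u ∈ Y := fun u => mem_of_mem_cands hF hQ
  obtain ⟨π, hπ, rfl, rfl, rfl⟩ := exists_respectsPerm hF hN (hY x (by simp [hPc]))
    (hY y (by simp [hPc])) (hY z (by simp [hPc])) (hY' a (by simp [hc])) (hY' b (by simp [hc]))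
    (hY' c (by simp [hc])) hxy hxz hyz hab hac hbc
  rw [hπ.winners_eq hPw hP hQ (by simp [hc, hPc])]
  · exact Finset.mem_map_of_mem π.toEmbedding hx
  · have hself : ∀ (R : Profile 𝒱 𝒳) u, R.margin u u = 0 := fun R u => by simp [Profile.margin]
    have s₁ := P.margin_swap x y
    have s₂ := P.margin_swap y z
    have s₃ := P.margin_swap z x
    have t₁ := Q.margin_swap (π x) (π y)
    have t₂ := Q.margin_swap (π y) (π z)
    have t₃ := Q.margin_swap (π z) (π x)
    simp only [hPc, Finset.mem_insert, Finset.mem_singleton]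
    rintro u (rfl | rfl | rfl) v (rfl | rfl | rfl) <;>
      simp only [hself, s₁, s₂, s₃, t₁, t₂, t₃, e₁, e₂, e₃, h₁, h₂, h₃]

theorem EdgeWin.winners_eq (hF : F.dom = {P | P.Admissible Y}) (hN : F.Neutrality)
    (hY : 4 ≤ Y.encard) (hPw : F.Pairwise) {m : ℤ} (h : F.EdgeWin m) {Q : Profile 𝒱 𝒳}
    (hQ : Q ∈ F.dom) {a b : 𝒳} (hab : a ≠ b) (hc : Q.cands = {a, b}) (hm : Q.margin a b = m) :
    F.winners Q = {a} := by
  obtain ⟨P, hP, x, y, hxy, hPc, e, hx⟩ := h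
  -- `exists_respectsPerm` moves three points, so each pair is padded with a dummy third point of
  -- `Y`.
  have third : ∀ u v : 𝒳, ∃ w ∈ Y, u ≠ w ∧ v ≠ w := fun u v => by
    by_contra! H
    have : Y ⊆ {u, v} := fun w hw => by
      by_cases h : u = w
      · simp [h]
      · simp [H w hw h]
    have h₂ : ({u, v} : Set 𝒳).encard ≤ 2 := (Set.encard_insert_le _ _).trans (by
      rw [Set.encard_singleton]
      rfl)
    exact absurd (hY.trans ((Set.encard_le_encard this).trans h₂)) (by decide)
  have hY : ∀ u ∈ P.cands, u ∈ Y := fun u => mem_of_mem_cands hF hP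
  have hY' : ∀ u ∈ Q.cands, u ∈ Y := fun u => mem_of_mem_cands hF hQ
  obtain ⟨z, hz, hxz, hyz⟩ := third x y
  obtain ⟨c, hc', hac, hbc⟩ := third a b
  obtain ⟨π, hπ, rfl, rfl, -⟩ := exists_respectsPerm hF hN (hY x (by simp [hPc]))
    (hY y (by simp [hPc])) hz (hY' a (by simp [hc])) (hY' b (by simp [hc]))
    hc' hxy hxz hyz hab hac hbc
  rw [hπ.winners_eq hPw hP hQ (by simp [hc, hPc]), hx]
  · simp
  · have hself : ∀ (R : Profile 𝒱 𝒳) u, R.margin u u = 0 := fun R u => by simp [Profile.margin]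
    have s := P.margin_swap x y
    have t := Q.margin_swap (π x) (π y)
    simp only [hPc, Finset.mem_insert, Finset.mem_singleton]
    rintro u (rfl | rfl) v (rfl | rfl) <;> simp only [hself, s, t, e, hm]

/-- Binary `γ`, for a candidate `x` who wins a cycle without `w` and wins against `w`. -/
theorem mem_winners_of_cycleWin (hF : F.dom = {P | P.Admissible Y})
    (hN : F.Neutrality) (hY : 4 ≤ Y.encard) (hPw : F.Pairwise) (hG : F.BinaryGamma)
    {P : Profile 𝒱 𝒳} (hP : P ∈ F.dom) {x y z w : 𝒳} (hxy : x ≠ y) (hxz : x ≠ z) (hyz : y ≠ z)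
    (hxw : x ≠ w) (hyw : y ≠ w) (hzw : z ≠ w) (hc : P.cands = {x, y, z, w})
    (hcyc : F.CycleWin (P.margin x y) (P.margin y z) (P.margin z x))
    (hedge : F.EdgeWin (P.margin x w)) : x ∈ F.winners P := by
  have hres : ∀ A : Finset 𝒳, x ∈ A → P.restrict A ∈ F.dom := fun A hA => by
    rw [hF] at hP ⊢
    exact Profile.Admissible.restrict hP ⟨x, by simp [hc, hA]⟩
  have hA : P.cands \ {w} = {x, y, z} := by
    ext u
    simp only [hc, Finset.mem_sdiff, Finset.mem_insert, Finset.mem_singleton]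
    grind
  have hr₁ : P.remove w ∈ F.dom := hres _ (by simp [hA])
  have hr₂ : P.restrict {x, w} ∈ F.dom := hres _ (by simp)
  refine hG P hP x w hr₁ hr₂ ?_ ?_
  · refine hcyc.mem_winners hF hN hPw hr₁ hxy hxz hyz ?_ ?_ ?_ ?_
    · change P.cands ∩ (P.cands \ {w}) = _
      rw [← hA]
      exact Finset.inter_eq_right.2 Finset.sdiff_subset
    all_goals exact P.margin_restrict _ (by simp [hA]) (by simp [hA])
  · refine hedge.winners_eq hF hN hY hPw hr₂ hxw ?_ (P.margin_restrict _ (by simp) (by simp))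
    change P.cands ∩ {x, w} = _
    exact Finset.inter_eq_right.2 (by simp [hc, Finset.insert_subset_iff])

end

end VotingMethod

/-! ### The impossibility theorem -/

theorem mainTheorem8 {𝒱 𝒳 : Type*} [Infinite 𝒱] [Infinite 𝒳] [DecidableEq 𝒱] [DecidableEq 𝒳]
    (Y : Set 𝒳) (hY : 4 ≤ Y.encard) :
    ¬ ∃ F : VotingMethod 𝒱 𝒳,
      F.dom = {P : Profile 𝒱 𝒳 | P.cands.Nonempty ∧ (P.cands : Set 𝒳) ⊆ Y ∧
        P.marginGraph.UniquelyWeighted ∧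
        P.marginGraph.PositiveWeightsIn {2, 4, 6, 8, 10, 12}} ∧
      F.Pairwise ∧ F.Anonymity ∧ F.Neutrality ∧ F.BinaryGamma ∧ F.QuasiResoluteness := by
  rintro ⟨F, hF, hPw, -, hN, hG, hQ⟩
  replace hF : F.dom = {P | P.Admissible Y} := hF
  obtain ⟨T, hTY, hT⟩ := Set.exists_subset_encard_eq hY
  obtain ⟨a, b, c, d, hab, hac, had, hbc, hbd, hcd, rfl⟩ := Set.encard_eq_four.1 hT
  obtain ⟨ha, hb, hc, hd⟩ : a ∈ Y ∧ b ∈ Y ∧ c ∈ Y ∧ d ∈ Y :=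
    ⟨hTY (by simp), hTY (by simp), hTY (by simp), hTY (by simp)⟩
  have hcard : Profile.labels.card = 6 := by decide
  have hres : ∀ P ∈ F.dom, ∀ A : Finset 𝒳, (P.cands ∩ A).Nonempty → P.restrict A ∈ F.dom :=
    fun P hP A hA => by
      rw [hF] at hP ⊢
      exact Profile.Admissible.restrict hP hA
  have huniq : ∀ P ∈ F.dom, ∃ x ∈ P.cands, F.winners P = {x} := fun P hP => by
    obtain ⟨x, hx⟩ := Finset.card_eq_one.1 (hQ P hP (by rw [hF] at hP; exact hP.2.2.1))
    exact ⟨x, F.winners_subset P hP (by simp [hx]), hx⟩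
  have triple : ∀ m₁ m₂ m₃ : ℤ, |m₁| ∈ Profile.labels → |m₂| ∈ Profile.labels →
      |m₃| ∈ Profile.labels → |m₁| ≠ |m₂| → |m₁| ≠ |m₃| → |m₂| ≠ |m₃| → ∃ P ∈ F.dom,
        P.cands = {a, b, c} ∧ P.margin a b = m₁ ∧ P.margin b c = m₂ ∧ P.margin c a = m₃ := by
    intro m₁ m₂ m₃ h₁ h₂ h₃ h₁₂ h₁₃ h₂₃
    rw [hF]
    exact Profile.exists_admissible_three ha hb hc hd hab hac had hbc hbd hcd h₁ h₂ h₃ h₁₂ h₁₃ h₂₃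
  -- The two-candidate profile is cut out of a cycle with filler labels `p`, `q`; the sign of `m`
  -- records whether `a` or `b` wins it.
  have hsign : ∀ k ∈ Profile.labels, ∃ m : ℤ, |m| = k ∧ F.EdgeWin m := fun k hk => by
    obtain ⟨p, hp, q, hq, hpk, hqk, hpq⟩ : ∃ p ∈ Profile.labels, ∃ q ∈ Profile.labels,
        p ≠ k ∧ q ≠ k ∧ p ≠ q := by
      revert k
      decide
    obtain ⟨P, hP, hPc, e, -, -⟩ := triple k p q (by rwa [Profile.abs_of_mem_labels k hk]) (by rwa [Profile.abs_of_mem_labels p hp])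
      (by rwa [Profile.abs_of_mem_labels q hq]) (by rw [Profile.abs_of_mem_labels k hk, Profile.abs_of_mem_labels p hp]; exact hpk.symm)
      (by rw [Profile.abs_of_mem_labels k hk, Profile.abs_of_mem_labels q hq]; exact hqk.symm) (by rwa [Profile.abs_of_mem_labels p hp, Profile.abs_of_mem_labels q hq])
    have hR : P.restrict {a, b} ∈ F.dom := hres P hP _ ⟨a, by simp [hPc]⟩
    have hRc : (P.restrict {a, b}).cands = {a, b} :=
      Finset.inter_eq_right.2 (by simp [hPc, Finset.insert_subset_iff])
    have hm : (P.restrict {a, b}).margin a b = k := by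
      rw [Profile.margin_restrict _ _ (by simp) (by simp), e]
    obtain ⟨x, hx, hw⟩ := huniq _ hR
    rw [hRc, Finset.mem_insert, Finset.mem_singleton] at hx
    rcases hx with rfl | rfl
    · exact ⟨k, Profile.abs_of_mem_labels k hk, _, hR, _, _, hab, hRc, hm, hw⟩
    · exact ⟨-k, by rw [abs_neg, Profile.abs_of_mem_labels k hk], _, hR, _, _, hab.symm,
        by rw [hRc, Finset.pair_comm], by rw [Profile.margin_swap, hm], hw⟩
  choose! l hl hlw using hsign
  have hlm : ∀ k ∈ Profile.labels, |l k| ∈ Profile.labels := fun k hk => by rwa [hl k hk]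
  refine not_exists_cyclic_choice Profile.labels hcard.ge
    (fun p q e => F.CycleWin (l p) (l q) (l e)) ?_ ?_
  -- The unique winner of one cyclic profile on `a`, `b`, `c` decides which rotation of `p q e` is
  -- picked.
  · intro p hp q hq e he hpq hpe hqe
    obtain ⟨P, hP, hPc, e₁, e₂, e₃⟩ := triple (l p) (l q) (l e) (hlm p hp) (hlm q hq) (hlm e he)
      (by rwa [hl p hp, hl q hq]) (by rwa [hl p hp, hl e he]) (by rwa [hl q hq, hl e he])
    obtain ⟨x, hx, hw⟩ := huniq P hP
    have hw' : x ∈ F.winners P := by simp [hw]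
    simp only [hPc, Finset.mem_insert, Finset.mem_singleton] at hx
    rcases hx with rfl | rfl | rfl
    · exact Or.inl ⟨P, hP, _, _, _, hab, hac, hbc, hPc, e₁, e₂, e₃, hw'⟩
    · refine Or.inr (Or.inl ⟨P, hP, _, _, _, hbc, hab.symm, hac.symm, ?_, e₂, e₃, e₁, hw'⟩)
      rw [hPc, Finset.insert_comm, Finset.pair_comm]
    · refine Or.inr (Or.inr ⟨P, hP, _, _, _, hac.symm, hbc.symm, hab, ?_, e₃, e₁, e₂, hw'⟩)
      rw [hPc, Finset.pair_comm, Finset.insert_comm]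
  · intro p hp q hq e he r hr s hs hnd h₁ h₂
    -- The pair `b`, `c` needs the one label not used by the two cycles.
    obtain ⟨t, ht, ht'⟩ : ∃ t ∈ Profile.labels, t ∉ ({p, q, e, r, s} : Finset ℤ) :=
      Finset.exists_mem_notMem_of_card_lt_card (by
        rw [hcard]
        exact Nat.lt_succ_of_le Finset.card_le_five)
    obtain ⟨P, hP, hPc, e₁, e₂, e₃, e₄, e₅, e₆⟩ := Profile.exists_admissible_four (𝒱 := 𝒱)
      ha hb hc hd hab hac had hbc hbd hcd (m₁ := l r) (m₂ := l p) (m₃ := -l e) (m₄ := l t)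
      (m₅ := l s) (m₆ := l q) (by
        simp only [abs_neg, hl _ hp, hl _ hq, hl _ he, hl _ hr, hl _ hs, hl _ ht]
        simp only [Finset.mem_insert, Finset.mem_singleton] at ht'
        grind) (by
        simp only [List.forall_mem_cons, abs_neg]
        exact ⟨hlm r hr, hlm p hp, hlm e he, hlm t ht, hlm s hs, hlm q hq, by simp⟩)
    have hPF : P ∈ F.dom := by rwa [hF]
    have e₃' : P.margin d a = l e := by rw [Profile.margin_swap, e₃, neg_neg]
    -- Delete `b`: the cycle `a`, `c`, `d` carries `p`, `q`, `e`, and `a` beats `b` along `r`.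
    have wa : a ∈ F.winners P := VotingMethod.mem_winners_of_cycleWin hF hN hY hPw hG hPF
      hac had hcd hab hbc.symm hbd.symm
      (by rw [hPc, Finset.insert_comm b c, Finset.pair_comm b d])
      (by rwa [e₂, e₆, e₃']) (by rw [e₁]; exact hlw r hr)
    -- Delete `c`: the cycle `b`, `d`, `a` carries `s`, `e`, `r`, and `b` beats `c` along `t`.
    have wb : b ∈ F.winners P := VotingMethod.mem_winners_of_cycleWin hF hN hY hPw hG hPF
      hbd hab.symm had.symm hbc hcd.symm hac
      (by rw [hPc, Finset.insert_comm a b, Finset.pair_comm c d, Finset.insert_comm a d])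
      (by rwa [e₅, e₃', e₁]) (by rw [e₄]; exact hlw t ht)
    obtain ⟨x, -, hw⟩ := huniq P hPF
    rw [hw, Finset.mem_singleton] at wa wb
    exact hab (wa.trans wb.symm)
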